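/- Let $p$ be a prime, let $q=p^e>3$ be an odd prime power, and let $\mathbb F_q$ be the field with $q$ elements. Let $V_n=(\mathbb C^q)^{\otimes n}$ be the Hilbert space with orthonormal basis $|x\rangle$, $x\in\mathbb F_q^n$. For $a,b\in\mathbb F_q^n$ let $X(a)|x\rangle=|x+a\rangle$ and $Z(b)|x\rangle=\omega^{\sum_i \mathrm{tr}(b_ix_i)}|x\rangle$, where $\omega=e^{2\pi i/p}$ and $\mathrm{tr}$ is the trace from $\mathbb F_q$ to $\mathbb F_p$. The errors are the operators $E=\omega^cX(a)Z(b)$ with $c\in\mathbb F_p$ and $a,b\in\mathbb F_q^n$, and the weight of such an $E$ is the number of $i$ with $(a_i,b_i)\neq(0,0)$. A subspace $Q\subseteq V_n$ detects $t$ errors if $\langle u|E|v\rangle=0$ for all $u,v\in Q$ with $\langle u|v\rangle=0$ and all errors $E$ of weight at most $t$ and, in case $\dim Q=1$, also $\langle u|E|v\rangle=0$ for all $u,v\in Q$ and all errors $E$ of weight between $1$ and $t$. An $[[n,k,d]]_q$ quantum code is a subspace $Q\subseteq V_n$ of dimension $q^k$ that detects $d-1$ errors, where $d\ge 1$ is the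 largest integer with this property; it is a quantum MDS code if $2d=n-k+2$. (1) For every integer $k$ with $\lceil\frac{q+2}{2}\rceil\le k\le q+1$ there exists a $[[q+1,\,2k-q-1,\,q-k+2]]_q$ quantum MDS code. (2) There exists a $[[q+1,\,0,\,\frac{q+1}{2}+1]]_q$ quantum MDS code. -/

import Mathlib

namespace QuantumCode

/-- The state space `V_n = ℂ^q ⊗ ⋯ ⊗ ℂ^q = ℂ^(q^n)`, in coordinates with respect to its orthonormal
basis `|c⟩`, `c ∈ F^n`, where `F` is the field with `q` elements. -/
abbrev StateSpace (F : Type*) [Fintype F] (n : ℕ) : Type _ :=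
  EuclideanSpace ℂ (Fin n → F)

section Operators

variable {F : Type*} [Field F] [Fintype F] {n : ℕ}

/-- The basis vector `|c⟩ = |c₁⟩ ⊗ ⋯ ⊗ |cₙ⟩`. -/
noncomputable def ket [DecidableEq F] (c : Fin n → F) : StateSpace F n :=
  EuclideanSpace.single c 1

/-- The operator `X(a) = X(a₁) ⊗ ⋯ ⊗ X(aₙ)`, that is, `X(a)|x⟩ = |x + a⟩`
(see `shiftX_ket`). -/
noncomputable def shiftX (a : Fin n → F) : StateSpace F n →ₗ[ℂ] StateSpace F n where
  toFun v := WithLp.toLp 2 fun x => v (x - a)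
  map_add' _ _ := rfl
  map_smul' _ _ := rfl

theorem shiftX_apply (a : Fin n → F) (v : StateSpace F n) (x : Fin n → F) :
    shiftX a v x = v (x - a) := rfl

theorem shiftX_ket [DecidableEq F] (a x : Fin n → F) : shiftX a (ket x) = ket (x + a) := by
  ext y
  simp [shiftX_apply, ket, sub_eq_iff_eq_add]

variable (p : ℕ) [Fact p.Prime] [Algebra (ZMod p) F]

/-- The phase `ω^{tr(b x)}`, where `ω = exp(2πi/p)` and `tr` is the trace map from `F` to `F_p`;
`ZMod.stdAddChar` is `j ↦ exp(2πi j/p)`. -/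
noncomputable def phase (b x : F) : ℂ :=
  ZMod.stdAddChar (Algebra.trace (ZMod p) F (b * x))

/-- The operator `Z(b) = Z(b₁) ⊗ ⋯ ⊗ Z(bₙ)`, that is,
`Z(b)|x⟩ = (∏ i, ω^{tr(bᵢ xᵢ)}) |x⟩` (see `clockZ_ket`). -/
noncomputable def clockZ (b : Fin n → F) : StateSpace F n →ₗ[ℂ] StateSpace F n where
  toFun v := WithLp.toLp 2 fun x => (∏ i, phase p (b i) (x i)) * v x
  map_add' v w := by ext x; simp [mul_add]
  map_smul' c v := by ext x; simp [mul_left_comm]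

theorem clockZ_ket [DecidableEq F] (b x : Fin n → F) :
    clockZ p b (ket x) = (∏ i, phase p (b i) (x i)) • ket x := by
  ext y
  by_cases h : y = x
  · subst h; simp [clockZ, ket]
  · simp [clockZ, ket, h]

/-- The element `ω^c X(a) Z(b)` of the error group `G_n`, for `c ∈ F_p` and `a, b ∈ F^n`. -/
noncomputable def errorOp (c : ZMod p) (a b : Fin n → F) :
    StateSpace F n →ₗ[ℂ] StateSpace F n :=
  (ZMod.stdAddChar c : ℂ) • (shiftX a ∘ₗ clockZ p b)

/-- The quantum weight of `ω^c X(a) Z(b)`: the number of positions `i` with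
`(aᵢ, bᵢ) ≠ (0, 0)`. -/
def errorWeight [DecidableEq F] (a b : Fin n → F) : ℕ :=
  hammingNorm fun i => (a i, b i)

/-- `⟨u|e|v⟩ = 0` for all orthogonal `u, v ∈ Q` and all errors `e ∈ G_n` of weight at most `t`. -/
def OrthogonalUpTo [DecidableEq F] (Q : Submodule ℂ (StateSpace F n)) (t : ℕ) : Prop :=
  ∀ u ∈ Q, ∀ v ∈ Q, inner ℂ u v = 0 →
    ∀ (c : ZMod p) (a b : Fin n → F), errorWeight a b ≤ t →
      inner ℂ u (errorOp p c a b v) = 0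

/-- `⟨u|e|v⟩ = 0` for all `u, v ∈ Q` and all errors `e ∈ G_n` of weight between `1` and `t`. -/
def PureUpTo [DecidableEq F] (Q : Submodule ℂ (StateSpace F n)) (t : ℕ) : Prop :=
  ∀ u ∈ Q, ∀ v ∈ Q,
    ∀ (c : ZMod p) (a b : Fin n → F), 1 ≤ errorWeight a b → errorWeight a b ≤ t →
      inner ℂ u (errorOp p c a b v) = 0

/-- `Q` detects `t` errors. For a one-dimensional `Q` the orthogonality condition is void, and by
the usual convention such a code is required to be pure. -/
def Detects [DecidableEq F] (Q : Submodule ℂ (StateSpace F n)) (t : ℕ) : Prop :=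
  OrthogonalUpTo p Q t ∧ (Module.finrank ℂ Q = 1 → PureUpTo p Q t)

/-- `Q` is an `[[n, k, d]]_q` quantum code: it has dimension `q^k`, it detects `d - 1` errors, and
`d ≥ 1` is the largest number with this property. -/
structure HasParameters [DecidableEq F] (Q : Submodule ℂ (StateSpace F n)) (k d : ℕ) : Prop where
  finrank_eq : Module.finrank ℂ Q = Fintype.card F ^ k
  one_le : 1 ≤ d
  detects : Detects p Q (d - 1)
  not_detects : ¬ Detects p Q d

/-- `Q` is an `[[n, k, d]]_q` quantum MDS code: it attains the quantum Singleton bound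
`2 d ≤ n - k + 2`. -/
structure IsMDS [DecidableEq F] (Q : Submodule ℂ (StateSpace F n)) (k d : ℕ) : Prop where
  hasParameters : HasParameters p Q k d
  singleton_eq : 2 * (d : ℤ) = (n : ℤ) - (k : ℤ) + 2

end Operators

end QuantumCode

/-! Let `h` be a binary form of degree `k` without zeros among `n` points of the projective line
over `F`. The values at these points of the forms of degree `r + k - 1`, and of the multiples by
`h` of the forms of degree `r - 1`, form nested generalized Reed-Solomon codes `C₂ ≤ C₁` of
dimensions `r` and `r + k`. Both are MDS, and so is the dual of `C₂`, so if `2 * r + k = n`, the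
nonzero words of `C₁` and of the dual of `C₂` all have weight at least `r + 1`. The CSS code of `C₂
≤ C₁` is then an `[[n, k, r + 1]]` code. For `k ≠ 1` an irreducible polynomial of degree `k` (or a
constant) provides `h` without zeros on the whole projective line; a linear form has one zero, so
`k = 1` leaves room for only `|F|` points. -/

section LinearCodes

variable {F ι : Type*} [Field F] [DecidableEq F] [Fintype ι]

theorem hammingNorm_add_card_filter_eq_zero (c : ι → F) :
    hammingNorm c + (Finset.univ.filter fun i => c i = 0).card = Fintype.card ι := by
  rw [hammingNorm, add_comm, Finset.card_filter_add_card_filter_not, Finset.card_univ]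

theorem hammingNorm_add_card_le {c : ι → F} {S : Finset ι} (hS : ∀ i ∈ S, c i = 0) :
    hammingNorm c + S.card ≤ Fintype.card ι := by
  rw [← hammingNorm_add_card_filter_eq_zero c]
  exact Nat.add_le_add_left (Finset.card_le_card fun i hi => by simpa using hS i hi) _

theorem exists_ne_zero_hammingNorm_add_finrank_le {C : Submodule F (ι → F)} (hC : C ≠ ⊥) :
    ∃ c ∈ C, c ≠ 0 ∧ hammingNorm c + Module.finrank F C ≤ Fintype.card ι + 1 := by
  have hpos : 0 < Module.finrank F C := Submodule.one_le_finrank_iff.2 hC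
  have hle : Module.finrank F C ≤ Fintype.card ι := by
    simpa only [Module.finrank_fintype_fun_eq_card] using C.finrank_le
  obtain ⟨S, -, hS⟩ := Finset.exists_subset_card_eq
    (s := (Finset.univ : Finset ι)) (n := Module.finrank F C - 1) (by rw [Finset.card_univ]; omega)
  obtain ⟨c, hc, hc0⟩ := (Submodule.ne_bot_iff _).1 <| LinearMap.ker_ne_bot_of_finrank_lt
    (f := (LinearMap.funLeft F F (Subtype.val : S → ι)).domRestrict C)
    (by rw [Module.finrank_fintype_fun_eq_card, Fintype.card_coe]; omega)
  refine ⟨c, c.2, fun h => hc0 (Subtype.ext h), ?_⟩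
  have := hammingNorm_add_card_le (c := (c : ι → F)) (S := S) fun i hi => congrFun hc ⟨i, hi⟩
  omega

/-- A maximum distance separable linear code: every nonzero word has weight at least
`n - dim C + 1`, the largest minimum distance that the Singleton bound allows. -/
def IsMDSCode (C : Submodule F (ι → F)) : Prop :=
  ∀ c ∈ C, c ≠ 0 → Fintype.card ι < Module.finrank F C + hammingNorm c

namespace IsMDSCode

variable {C : Submodule F (ι → F)}

theorem exists_forall_mem_eq (hC : IsMDSCode C) {S : Finset ι} (hS : S.card = Module.finrank F C)
    (x : ι → F) : ∃ c ∈ C, ∀ i ∈ S, c i = x i := by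
  let restrict := (LinearMap.funLeft F F (Subtype.val : S → ι)).domRestrict C
  have hinj : Function.Injective restrict := by
    rw [injective_iff_map_eq_zero]
    intro c hc
    by_contra hc0
    have hlt := hC c c.2 fun h => hc0 (Subtype.ext h)
    have hle := hammingNorm_add_card_le (c := (c : ι → F)) (S := S) fun i hi => congrFun hc ⟨i, hi⟩
    omega
  have hsurj : Function.Surjective restrict :=
    (LinearMap.injective_iff_surjective_of_finrank_eq_finrank (by simp [hS])).1 hinj
  obtain ⟨c, hc⟩ := hsurj fun i => x i
  exact ⟨c, c.2, fun i hi => congrFun hc ⟨i, hi⟩⟩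

/-- That is, the dual of a maximum distance separable code has minimum distance at least
`dim C + 1`. -/
theorem exists_dotProduct_ne_zero (hC : IsMDSCode C) {b : ι → F} (hb : b ≠ 0)
    (hbC : hammingNorm b ≤ Module.finrank F C) : ∃ c ∈ C, b ⬝ᵥ c ≠ 0 := by
  classical
  obtain ⟨i, hi⟩ := Function.ne_iff.1 hb
  obtain ⟨S, hbS, hS⟩ := Finset.exists_superset_card_eq hbC
    (by simpa only [Module.finrank_fintype_fun_eq_card] using C.finrank_le)
  obtain ⟨c, hc, hcS⟩ := hC.exists_forall_mem_eq hS (Pi.single i 1)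
  refine ⟨c, hc, ?_⟩
  suffices b ⬝ᵥ c = b i by rwa [this]
  rw [← dotProduct_single_one b i]
  refine Finset.sum_congr rfl fun j _ => ?_
  by_cases hj : b j = 0
  · simp only [hj, zero_mul]
  · rw [hcS j (hbS (by simpa using hj))]

end IsMDSCode

end LinearCodes

section ReedSolomon

open Polynomial

variable {F ι : Type*} [Field F]

/-- The value at a point of the projective line, where `none` is the point at infinity, of the
binary form of degree `m` obtained by homogenizing a polynomial of degree at most `m`. -/
noncomputable def projEval (m : ℕ) (x : Option F) : F[X] →ₗ[F] F :=
  x.elim (lcoeff F m) leval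

theorem projEval_some (m : ℕ) (x : F) (f : F[X]) : projEval m (some x) f = f.eval x := rfl

theorem projEval_none (m : ℕ) (f : F[X]) : projEval m none f = f.coeff m := rfl

theorem projEval_mul {k m : ℕ} (x : Option F) {h f : F[X]} (hh : h.natDegree ≤ k)
    (hf : f.natDegree ≤ m) : projEval (k + m) x (h * f) = projEval k x h * projEval m x f := by
  cases x with
  | none => exact coeff_mul_add_eq_of_natDegree_le hh hf
  | some x => exact eval_mul

theorem card_le_of_forall_projEval_eq_zero {m : ℕ} {f : F[X]} (hf0 : f ≠ 0) (hf : f.natDegree ≤ m)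
    {S : Finset (Option F)} (hS : ∀ x ∈ S, projEval m x f = 0) : S.card ≤ m := by
  have hroots : S.eraseNone.card ≤ f.natDegree := by
    refine card_le_degree_of_subset_roots fun x hx => ?_
    exact (mem_roots hf0).2 (hS _ (Finset.mem_eraseNone.1 hx))
  by_cases hnone : none ∈ S
  · have hdeg : f.natDegree ≠ m := by
      rintro rfl
      exact hf0 (leadingCoeff_eq_zero.1 (hS _ hnone))
    rw [Finset.card_eraseNone_of_mem hnone] at hroots
    omega
  · rw [Finset.card_eraseNone_of_not_mem hnone] at hroots
    omega

theorem natDegree_le_of_mem_degreeLT {r : ℕ} {f : F[X]} (hf : f ∈ degreeLT F r) :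
    f.natDegree ≤ r - 1 := by
  rcases eq_or_ne f 0 with rfl | hf0
  · exact natDegree_zero.trans_le (Nat.zero_le _)
  · exact Nat.le_sub_one_of_lt ((natDegree_lt_iff_degree_lt hf0).2 (mem_degreeLT.1 hf))

/-- The word with entries `vᵢ f(eᵢ)`, where the polynomial `f` of degree less than `r` is viewed as
a binary form of degree `r - 1`. For `r = 0` the truncation `r - 1 = 0` is harmless, since then
`f = 0`. -/
noncomputable def reedSolomonWord (e : ι → Option F) (v : ι → F) (r : ℕ) :
    degreeLT F r →ₗ[F] (ι → F) :=
  (LinearMap.pi fun i => v i • projEval (r - 1) (e i)).domRestrict (degreeLT F r)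

theorem reedSolomonWord_apply (e : ι → Option F) (v : ι → F) (r : ℕ) (f : degreeLT F r) (i : ι) :
    reedSolomonWord e v r f i = v i * projEval (r - 1) (e i) f := rfl

/-- The generalized Reed-Solomon code of dimension `r` with evaluation points `e` on the projective
line and column multipliers `v`. -/
noncomputable def generalizedReedSolomon (e : ι → Option F) (v : ι → F) (r : ℕ) :
    Submodule F (ι → F) :=
  LinearMap.range (reedSolomonWord e v r)

/-- The inclusion is multiplication by the form `h`. -/
theorem generalizedReedSolomon_le (e : ι → Option F) {k : ℕ} (r : ℕ) {h : F[X]}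
    (hh : h.natDegree ≤ k) :
    generalizedReedSolomon e (fun i => projEval k (e i) h) r ≤
      generalizedReedSolomon e 1 (r + k) := by
  rintro _ ⟨f, rfl⟩
  rcases Nat.eq_zero_or_pos r with rfl | hr
  · obtain rfl : f = 0 := Subtype.ext (by simpa using mem_degreeLT.1 f.2)
    rw [map_zero]
    exact zero_mem _
  have hf := natDegree_le_of_mem_degreeLT f.2
  have hmul : h * f.1 ∈ degreeLT F (r + k) := by
    rw [mem_degreeLT]
    refine degree_le_natDegree.trans_lt (Nat.cast_lt.2 ?_)
    have := natDegree_mul_le (p := h) (q := f.1)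
    omega
  refine ⟨⟨_, hmul⟩, funext fun i => ?_⟩
  rw [reedSolomonWord_apply, reedSolomonWord_apply, Pi.one_apply, one_mul,
    show r + k - 1 = k + (r - 1) by omega]
  exact projEval_mul _ hh hf

variable [Fintype ι]

theorem card_lt_add_hammingNorm_reedSolomonWord [DecidableEq F] (e : ι ↪ Option F) {v : ι → F}
    (hv : ∀ i, v i ≠ 0) {r : ℕ} {f : degreeLT F r} (hf : f ≠ 0) :
    Fintype.card ι < r + hammingNorm (reedSolomonWord e v r f) := by
  have hf0 : f.1 ≠ 0 := fun h => hf (Subtype.ext h)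
  have hr : f.1.natDegree < r := (natDegree_lt_iff_degree_lt hf0).2 (mem_degreeLT.1 f.2)
  have hzeros := card_le_of_forall_projEval_eq_zero hf0 (Nat.le_sub_one_of_lt hr)
    (S := (Finset.univ.filter fun i => reedSolomonWord e v r f i = 0).map e) (by
      simp [reedSolomonWord_apply, hv])
  rw [Finset.card_map] at hzeros
  have := hammingNorm_add_card_filter_eq_zero (reedSolomonWord e v r f)
  omega

theorem finrank_generalizedReedSolomon (e : ι ↪ Option F) {v : ι → F} (hv : ∀ i, v i ≠ 0) {r : ℕ}
    (hr : r ≤ Fintype.card ι) : Module.finrank F (generalizedReedSolomon e v r) = r := by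
  classical
  have hinj : Function.Injective (reedSolomonWord e v r) := by
    rw [injective_iff_map_eq_zero]
    intro f hf
    by_contra hf0
    have := card_lt_add_hammingNorm_reedSolomonWord e hv hf0
    rw [hf, hammingNorm_zero] at this
    omega
  rw [generalizedReedSolomon, LinearMap.finrank_range_of_inj hinj,
    (degreeLTEquiv F r).finrank_eq, Module.finrank_fin_fun]

theorem isMDSCode_generalizedReedSolomon [DecidableEq F] (e : ι ↪ Option F) {v : ι → F}
    (hv : ∀ i, v i ≠ 0) {r : ℕ} (hr : r ≤ Fintype.card ι) :
    IsMDSCode (generalizedReedSolomon e v r) := by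
  rintro _ ⟨f, rfl⟩ hf
  rw [finrank_generalizedReedSolomon e hv hr]
  exact card_lt_add_hammingNorm_reedSolomonWord e hv fun h => hf (by rw [h, map_zero])

end ReedSolomon

section FiniteFields

open Polynomial

theorem exists_irreducible_natDegree_eq (F : Type*) [Field F] [Finite F] {k : ℕ} (hk : k ≠ 0) :
    ∃ h : F[X], Irreducible h ∧ h.natDegree = k := by
  have : NeZero k := ⟨hk⟩
  obtain ⟨p, hp⟩ := CharP.exists F
  have : Fact p.Prime := ⟨CharP.char_is_prime F p⟩
  let α := Field.powerBasisOfFiniteOfSeparable F (FiniteField.Extension F p k)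
  refine ⟨minpoly F α.gen, minpoly.irreducible α.isIntegral_gen, ?_⟩
  rw [α.natDegree_minpoly, ← α.finrank, FiniteField.finrank_extension]

/-- A linear form always has a zero on the projective line. -/
theorem exists_natDegree_le_forall_projEval_ne_zero (F : Type*) [Field F] [Finite F] {k : ℕ}
    (hk : k ≠ 1) : ∃ h : F[X], h.natDegree ≤ k ∧ ∀ x, projEval k x h ≠ 0 := by
  rcases eq_or_ne k 0 with rfl | hk0
  · refine ⟨1, natDegree_one.le, fun x => ?_⟩
    cases x <;> simp [projEval_none, projEval_some]
  · obtain ⟨h, hirr, rfl⟩ := exists_irreducible_natDegree_eq F hk0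
    refine ⟨h, le_rfl, fun x => ?_⟩
    cases x with
    | none => exact leadingCoeff_ne_zero.2 hirr.ne_zero
    | some x => exact hirr.not_isRoot_of_natDegree_ne_one hk

theorem exists_embedding_forall_projEval_ne_zero {F ι : Type*} [Field F] [Fintype F] [Fintype ι]
    {k : ℕ} (hι : Fintype.card ι ≤ Fintype.card F + 1)
    (hk : k = 1 → Fintype.card ι ≤ Fintype.card F) :
    ∃ (e : ι ↪ Option F) (h : F[X]), h.natDegree ≤ k ∧ ∀ i, projEval k (e i) h ≠ 0 := by
  by_cases hk1 : k = 1
  · obtain ⟨e⟩ := Function.Embedding.nonempty_of_card_le (hk hk1)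
    refine ⟨e.trans .some, 1, natDegree_one.trans_le (Nat.zero_le k), fun i => ?_⟩
    simp [projEval_some]
  · obtain ⟨e⟩ : Nonempty (ι ↪ Option F) :=
      Function.Embedding.nonempty_of_card_le (by rwa [Fintype.card_option])
    obtain ⟨h, hdeg, hne⟩ := exists_natDegree_le_forall_projEval_ne_zero F hk1
    exact ⟨e, h, hdeg, fun i => hne (e i)⟩

end FiniteFields

namespace QuantumCode

section ErrorWeight

variable {F : Type*} [Field F] [DecidableEq F] {n : ℕ}

theorem hammingNorm_le_errorWeight_left (a b : Fin n → F) : hammingNorm a ≤ errorWeight a b :=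
  hammingNorm_comp_le_hammingNorm (x := fun i => (a i, b i)) (fun _ => Prod.fst) fun _ => rfl

theorem hammingNorm_le_errorWeight_right (a b : Fin n → F) : hammingNorm b ≤ errorWeight a b :=
  hammingNorm_comp_le_hammingNorm (x := fun i => (a i, b i)) (fun _ => Prod.snd) fun _ => rfl

theorem errorWeight_zero_right (a : Fin n → F) : errorWeight a 0 = hammingNorm a :=
  hammingNorm_comp (fun _ x => (x, 0)) (fun _ => Prod.mk_left_injective 0) fun _ => rfl

theorem errorWeight_eq_zero {a b : Fin n → F} : errorWeight a b = 0 ↔ a = 0 ∧ b = 0 := by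
  simp only [errorWeight, hammingNorm_eq_zero, funext_iff, Prod.ext_iff, Pi.zero_apply,
    Prod.fst_zero, Prod.snd_zero, forall_and]

end ErrorWeight

section Operators

variable {F : Type*} [Field F] {n : ℕ} (p : ℕ) [Fact p.Prime] [Algebra (ZMod p) F]

theorem prod_phase (b x : Fin n → F) :
    ∏ i, phase p (b i) (x i) = ZMod.stdAddChar (Algebra.trace (ZMod p) F (b ⬝ᵥ x)) := by
  simp only [phase, dotProduct, map_sum]
  exact (map_prod (ZMod.stdAddChar (N := p)).toMonoidHom
    (fun i => Multiplicative.ofAdd (Algebra.trace (ZMod p) F (b i * x i))) Finset.univ).symm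

theorem exists_stdAddChar_trace_ne_one [Finite F] {C : Submodule F (Fin n → F)} {b : Fin n → F}
    (hb : ∃ c ∈ C, b ⬝ᵥ c ≠ 0) :
    ∃ y ∈ C, ZMod.stdAddChar (Algebra.trace (ZMod p) F (b ⬝ᵥ y)) ≠ (1 : ℂ) := by
  obtain ⟨c, hc, hbc⟩ := hb
  obtain ⟨s, hs⟩ := Algebra.trace_surjective (ZMod p) F 1
  refine ⟨(s / (b ⬝ᵥ c)) • c, C.smul_mem _ hc, ?_⟩
  rw [dotProduct_smul, smul_eq_mul, div_mul_cancel₀ _ hbc, hs,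
    ← AddChar.map_zero_eq_one (ZMod.stdAddChar (N := p))]
  exact ZMod.injective_stdAddChar.ne one_ne_zero

variable [Fintype F]

theorem errorOp_apply (c : ZMod p) (a b : Fin n → F) (v : StateSpace F n) (x : Fin n → F) :
    errorOp p c a b v x = ZMod.stdAddChar c *
      (ZMod.stdAddChar (Algebra.trace (ZMod p) F (b ⬝ᵥ (x - a))) * v (x - a)) := by
  rw [← prod_phase]
  rfl

theorem inner_errorOp (c : ZMod p) (a b : Fin n → F) (u v : StateSpace F n) :
    inner ℂ u (errorOp p c a b v) = ∑ x, ZMod.stdAddChar c *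
      (ZMod.stdAddChar (Algebra.trace (ZMod p) F (b ⬝ᵥ (x - a))) * v (x - a)) *
        starRingEnd ℂ (u x) := by
  simp only [PiLp.inner_apply, errorOp_apply, RCLike.inner_apply]

theorem errorOp_zero_right (a : Fin n → F) : errorOp p 0 a 0 = shiftX a := by
  ext v x
  simp [errorOp_apply, shiftX_apply]

theorem errorOp_zero_zero (c : ZMod p) (v : StateSpace F n) :
    errorOp p c 0 0 v = (ZMod.stdAddChar c : ℂ) • v := by
  ext x
  simp [errorOp_apply]

variable {p}

theorem PureUpTo.orthogonalUpTo [DecidableEq F] {Q : Submodule ℂ (StateSpace F n)} {t : ℕ}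
    (hQ : PureUpTo p Q t) : OrthogonalUpTo p Q t := by
  intro u hu v hv huv c a b ht
  rcases Nat.eq_zero_or_pos (errorWeight a b) with hweight | hweight
  · obtain ⟨rfl, rfl⟩ := errorWeight_eq_zero.1 hweight
    rw [errorOp_zero_zero, inner_smul_right, huv, mul_zero]
  · exact hQ u hu v hv c a b hweight ht

end Operators

section CSS

variable {F : Type*} [Field F] [Fintype F] {n : ℕ} {C₁ C₂ : Submodule F (Fin n → F)}

/-- The Calderbank-Shor-Steane code of `C₂ ≤ C₁`: the states supported on `C₁` that are invariant
under translation by `C₂`, that is, the span of the coset states `∑ c ∈ C₂, |x + c⟩` with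
`x ∈ C₁`. -/
def cssCode (C₁ C₂ : Submodule F (Fin n → F)) : Submodule ℂ (StateSpace F n) where
  carrier := {v | (∀ x ∉ C₁, v x = 0) ∧ ∀ c ∈ C₂, ∀ x, v (x + c) = v x}
  zero_mem' := by simp
  add_mem' := by
    rintro v w ⟨hv, hv'⟩ ⟨hw, hw'⟩
    exact ⟨fun x hx => by simp [hv x hx, hw x hx], fun c hc x => by simp [hv' c hc x, hw' c hc x]⟩
  smul_mem' := by
    rintro z v ⟨hv, hv'⟩
    exact ⟨fun x hx => by simp [hv x hx], fun c hc x => by simp [hv' c hc x]⟩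

/-- The state whose amplitudes are constant on the cosets of `C₂` in `C₁`, as prescribed by a
function on the quotient, and zero outside `C₁`. -/
noncomputable def cosetState (C₁ C₂ : Submodule F (Fin n → F)) :
    (C₁ ⧸ C₂.submoduleOf C₁ → ℂ) →ₗ[ℂ] StateSpace F n :=
  (WithLp.linearEquiv 2 ℂ ((Fin n → F) → ℂ)).symm.toLinearMap ∘ₗ
    Function.ExtendByZero.linearMap ℂ (Subtype.val : C₁ → Fin n → F) ∘ₗ
      LinearMap.funLeft ℂ ℂ (C₂.submoduleOf C₁).mkQ

theorem cosetState_apply_coe (g : C₁ ⧸ C₂.submoduleOf C₁ → ℂ) (x : C₁) :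
    cosetState C₁ C₂ g x = g ((C₂.submoduleOf C₁).mkQ x) :=
  Subtype.val_injective.extend_apply _ _ x

theorem cosetState_apply_of_notMem (g : C₁ ⧸ C₂.submoduleOf C₁ → ℂ) {x : Fin n → F}
    (hx : x ∉ C₁) : cosetState C₁ C₂ g x = 0 :=
  Function.extend_apply' _ _ _ fun ⟨y, hy⟩ => hx (hy ▸ y.2)

theorem injective_cosetState : Function.Injective (cosetState C₁ C₂) := by
  intro g g' hg
  ext y
  obtain ⟨x, rfl⟩ := (C₂.submoduleOf C₁).mkQ_surjective y
  rw [← cosetState_apply_coe g x, hg, cosetState_apply_coe g' x]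

theorem cosetState_mem_cssCode (h : C₂ ≤ C₁) (g : C₁ ⧸ C₂.submoduleOf C₁ → ℂ) :
    cosetState C₁ C₂ g ∈ cssCode C₁ C₂ := by
  refine ⟨fun x hx => cosetState_apply_of_notMem g hx, fun c hc x => ?_⟩
  by_cases hx : x ∈ C₁
  · have hxc : (C₂.submoduleOf C₁).mkQ ⟨x + c, C₁.add_mem hx (h hc)⟩ =
        (C₂.submoduleOf C₁).mkQ ⟨x, hx⟩ := by
      refine (Submodule.Quotient.eq _).2 ?_
      change x + c - x ∈ C₂
      rwa [add_sub_cancel_left]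
    rw [cosetState_apply_coe g ⟨x + c, C₁.add_mem hx (h hc)⟩, cosetState_apply_coe g ⟨x, hx⟩, hxc]
  · have hxc : x + c ∉ C₁ := fun hxc => hx ((C₁.add_mem_iff_left (h hc)).1 hxc)
    rw [cosetState_apply_of_notMem g hx, cosetState_apply_of_notMem g hxc]

theorem range_cosetState (h : C₂ ≤ C₁) :
    LinearMap.range (cosetState C₁ C₂) = cssCode C₁ C₂ := by
  refine le_antisymm ?_ fun v hv => ?_
  · rintro _ ⟨g, rfl⟩
    exact cosetState_mem_cssCode h g
  have hfactors : (fun x : C₁ => v x).FactorsThrough (C₂.submoduleOf C₁).mkQ := by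
    intro x y hxy
    have hmem : (x : Fin n → F) - y ∈ C₂ := (Submodule.Quotient.eq (C₂.submoduleOf C₁)).1 hxy
    simpa only [add_sub_cancel] using hv.2 _ hmem y
  refine ⟨Function.extend (C₂.submoduleOf C₁).mkQ (fun x : C₁ => v x) 0, ?_⟩
  ext x
  by_cases hx : x ∈ C₁
  · exact (cosetState_apply_coe _ ⟨x, hx⟩).trans (hfactors.extend_apply 0 ⟨x, hx⟩)
  · rw [cosetState_apply_of_notMem _ hx, hv.1 x hx]

theorem finrank_cssCode (h : C₂ ≤ C₁) :
    Module.finrank ℂ (cssCode C₁ C₂) =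
      Fintype.card F ^ (Module.finrank F C₁ - Module.finrank F C₂) := by
  classical
  have := Fintype.ofFinite (C₁ ⧸ C₂.submoduleOf C₁)
  rw [← range_cosetState h, LinearMap.finrank_range_of_inj injective_cosetState,
    Module.finrank_fintype_fun_eq_card, Module.card_eq_pow_finrank (K := F),
    Submodule.finrank_quotient, (Submodule.submoduleOfEquivOfLe h).finrank_eq]

theorem shiftX_mem_cssCode {w : Fin n → F} (hw : w ∈ C₁) {v : StateSpace F n}
    (hv : v ∈ cssCode C₁ C₂) : shiftX w v ∈ cssCode C₁ C₂ := by
  refine ⟨fun x hx => hv.1 _ fun hxw => hx ((C₁.sub_mem_iff_left hw).1 hxw), fun c hc x => ?_⟩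
  rw [shiftX_apply, shiftX_apply, add_sub_right_comm, hv.2 c hc]

/-- The unnormalized state `∑ c ∈ C, |c⟩`. -/
noncomputable def subspaceState (C : Submodule F (Fin n → F)) : StateSpace F n :=
  WithLp.toLp 2 ((C : Set (Fin n → F)).indicator 1)

theorem subspaceState_apply_of_mem {C : Submodule F (Fin n → F)} {x : Fin n → F} (hx : x ∈ C) :
    subspaceState C x = 1 :=
  Set.indicator_of_mem hx 1

theorem subspaceState_apply_of_notMem {C : Submodule F (Fin n → F)} {x : Fin n → F} (hx : x ∉ C) :
    subspaceState C x = 0 :=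
  Set.indicator_of_notMem hx 1

theorem subspaceState_mem_cssCode (h : C₂ ≤ C₁) : subspaceState C₂ ∈ cssCode C₁ C₂ := by
  refine ⟨fun x hx => subspaceState_apply_of_notMem fun hx₂ => hx (h hx₂), fun c hc x => ?_⟩
  by_cases hx : x ∈ C₂
  · rw [subspaceState_apply_of_mem hx, subspaceState_apply_of_mem (C₂.add_mem hx hc)]
  · rw [subspaceState_apply_of_notMem hx,
      subspaceState_apply_of_notMem fun hxc => hx ((C₂.add_mem_iff_left hc).1 hxc)]

theorem shiftX_subspaceState_ne_zero (C : Submodule F (Fin n → F)) (w : Fin n → F) :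
    shiftX w (subspaceState C) ≠ 0 := by
  intro h0
  have hw : shiftX w (subspaceState C) w = 1 := by
    rw [shiftX_apply, sub_self, subspaceState_apply_of_mem C.zero_mem]
  rw [h0] at hw
  exact zero_ne_one hw

theorem inner_shiftX_subspaceState {C : Submodule F (Fin n → F)} {w : Fin n → F} (hw : w ∉ C) :
    inner ℂ (shiftX w (subspaceState C)) (subspaceState C) = 0 := by
  rw [PiLp.inner_apply]
  refine Finset.sum_eq_zero fun x _ => ?_
  by_cases hx : x ∈ C
  · have hxw : x - w ∉ C := fun hxw => hw ((C.sub_mem_iff_right hx).1 hxw)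
    rw [shiftX_apply, subspaceState_apply_of_notMem hxw, inner_zero_left]
  · rw [subspaceState_apply_of_notMem hx, inner_zero_right]

variable {p : ℕ} [Fact p.Prime] [Algebra (ZMod p) F]

theorem inner_errorOp_eq_zero_of_notMem {a : Fin n → F} (ha : a ∉ C₁) (b : Fin n → F) (c : ZMod p)
    {u v : StateSpace F n} (hu : u ∈ cssCode C₁ C₂) (hv : v ∈ cssCode C₁ C₂) :
    inner ℂ u (errorOp p c a b v) = 0 := by
  rw [inner_errorOp]
  refine Finset.sum_eq_zero fun x _ => ?_
  by_cases hx : x ∈ C₁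
  · have hxa : x - a ∉ C₁ := fun hxa => ha ((C₁.sub_mem_iff_right hx).1 hxa)
    rw [hv.1 _ hxa, mul_zero, mul_zero, zero_mul]
  · rw [hu.1 _ hx, map_zero, mul_zero]

/-- Translating both states by `y ∈ C₂` fixes them but multiplies the inner product by
`ω ^ tr (b ⬝ y)`. -/
theorem inner_errorOp_eq_zero_of_dotProduct_ne_zero {b : Fin n → F} (hb : ∃ y ∈ C₂, b ⬝ᵥ y ≠ 0)
    (a : Fin n → F) (c : ZMod p) {u v : StateSpace F n} (hu : u ∈ cssCode C₁ C₂)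
    (hv : v ∈ cssCode C₁ C₂) : inner ℂ u (errorOp p c a b v) = 0 := by
  obtain ⟨y, hy, hphase⟩ := exists_stdAddChar_trace_ne_one p hb
  have htranslate : inner ℂ u (errorOp p c a b v) =
      ZMod.stdAddChar (Algebra.trace (ZMod p) F (b ⬝ᵥ y)) * inner ℂ u (errorOp p c a b v) := by
    conv_lhs => rw [inner_errorOp, ← Equiv.sum_comp (Equiv.addRight y)]
    rw [inner_errorOp, Finset.mul_sum]
    refine Finset.sum_congr rfl fun x _ => ?_
    rw [Equiv.coe_addRight, add_sub_right_comm, hv.2 y hy, hu.2 y hy, dotProduct_add, map_add,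
      AddChar.map_add_eq_mul]
    ring
  exact (mul_left_eq_self₀.1 htranslate.symm).resolve_left hphase

variable [DecidableEq F]

theorem pureUpTo_cssCode {t : ℕ} (hX : ∀ a ∈ C₁, a ≠ 0 → t < hammingNorm a)
    (hZ : ∀ b : Fin n → F, b ≠ 0 → hammingNorm b ≤ t → ∃ c ∈ C₂, b ⬝ᵥ c ≠ 0) :
    PureUpTo p (cssCode C₁ C₂) t := by
  intro u hu v hv c a b hpos ht
  by_cases ha : a = 0
  · have hb : b ≠ 0 := fun hb => Nat.one_le_iff_ne_zero.1 hpos (errorWeight_eq_zero.2 ⟨ha, hb⟩)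
    have hbt := (hammingNorm_le_errorWeight_right a b).trans ht
    exact inner_errorOp_eq_zero_of_dotProduct_ne_zero (hZ b hb hbt) a c hu hv
  · have hat := (hammingNorm_le_errorWeight_left a b).trans ht
    exact inner_errorOp_eq_zero_of_notMem (fun h => (hX a h ha).not_ge hat) b c hu hv

theorem not_pureUpTo_cssCode (h : C₂ ≤ C₁) {w : Fin n → F} (hw : w ∈ C₁) (hw0 : w ≠ 0) {t : ℕ}
    (ht : hammingNorm w ≤ t) : ¬ PureUpTo p (cssCode C₁ C₂) t := by
  intro hpure
  have hv := subspaceState_mem_cssCode h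
  refine (inner_self_ne_zero (𝕜 := ℂ)).2 (shiftX_subspaceState_ne_zero C₂ w) ?_
  have hinner := hpure _ (shiftX_mem_cssCode hw hv) _ hv 0 w 0
  rw [errorWeight_zero_right, errorOp_zero_right] at hinner
  exact hinner (hammingNorm_pos_iff.2 hw0) ht

theorem not_orthogonalUpTo_cssCode (h : C₂ ≤ C₁) {w : Fin n → F} (hw : w ∈ C₁) (hw₂ : w ∉ C₂)
    {t : ℕ} (ht : hammingNorm w ≤ t) : ¬ OrthogonalUpTo p (cssCode C₁ C₂) t := by
  intro horth
  have hv := subspaceState_mem_cssCode h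
  refine (inner_self_ne_zero (𝕜 := ℂ)).2 (shiftX_subspaceState_ne_zero C₂ w) ?_
  have hinner := horth _ (shiftX_mem_cssCode hw hv) _ hv (inner_shiftX_subspaceState hw₂) 0 w 0
  rw [errorWeight_zero_right, errorOp_zero_right] at hinner
  exact hinner ht

theorem isMDS_cssCode (h : C₂ ≤ C₁) (h₁ : IsMDSCode C₁) (h₂ : IsMDSCode C₂) (hC₁ : C₁ ≠ ⊥)
    (hn : Module.finrank F C₁ + Module.finrank F C₂ = n) :
    IsMDS p (cssCode C₁ C₂) (Module.finrank F C₁ - Module.finrank F C₂)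
      (Module.finrank F C₂ + 1) := by
  have hle := Submodule.finrank_mono h
  have hpure : PureUpTo p (cssCode C₁ C₂) (Module.finrank F C₂) := by
    refine pureUpTo_cssCode (fun a ha ha0 => ?_) fun b hb hbt => h₂.exists_dotProduct_ne_zero hb hbt
    have := h₁ a ha ha0
    rw [Fintype.card_fin] at this
    omega
  obtain ⟨w, hw, hw0, hweight⟩ := exists_ne_zero_hammingNorm_add_finrank_le hC₁
  rw [Fintype.card_fin] at hweight
  refine ⟨⟨finrank_cssCode h, Nat.le_add_left _ _, ⟨hpure.orthogonalUpTo, fun _ => hpure⟩, ?_⟩,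
    by omega⟩
  rintro ⟨horth, hpure'⟩
  by_cases hw₂ : w ∈ C₂
  · have hlt := h₂ w hw₂ hw0
    rw [Fintype.card_fin] at hlt
    refine not_pureUpTo_cssCode h hw hw0 (by omega) (hpure' ?_)
    rw [finrank_cssCode h, show Module.finrank F C₁ - Module.finrank F C₂ = 0 by omega, pow_zero]
  · exact not_orthogonalUpTo_cssCode h hw hw₂ (by omega) horth

end CSS

end QuantumCode

theorem theorem3p4_general (p : ℕ) [Fact p.Prime] {F : Type*} [Field F] [Fintype F] [DecidableEq F]
    [Algebra (ZMod p) F] {n k d : ℕ} (hn0 : n ≠ 0) (hn : n ≤ Fintype.card F + 1)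
    (hk : k = 1 → n ≤ Fintype.card F) (hd0 : d ≠ 0) (hd : 2 * d + k = n + 2) :
    ∃ Q : Submodule ℂ (QuantumCode.StateSpace F n), QuantumCode.IsMDS p Q k d := by
  obtain ⟨r, rfl⟩ := Nat.exists_eq_succ_of_ne_zero hd0
  obtain ⟨e, h, hdeg, hne⟩ := exists_embedding_forall_projEval_ne_zero (F := F) (ι := Fin n)
    (k := k) (by rwa [Fintype.card_fin]) (by rwa [Fintype.card_fin])
  have hone (i : Fin n) : (1 : Fin n → F) i ≠ 0 := one_ne_zero
  have hr₁ : r + k ≤ Fintype.card (Fin n) := by rw [Fintype.card_fin]; omega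
  have hr₂ : r ≤ Fintype.card (Fin n) := (Nat.le_add_right r k).trans hr₁
  have hdim₁ := finrank_generalizedReedSolomon e hone hr₁
  have hdim₂ := finrank_generalizedReedSolomon e hne hr₂
  have hMDS := QuantumCode.isMDS_cssCode (p := p) (generalizedReedSolomon_le e r hdeg)
    (isMDSCode_generalizedReedSolomon e hone hr₁) (isMDSCode_generalizedReedSolomon e hne hr₂)
    (Submodule.one_le_finrank_iff.1 (by rw [hdim₁]; omega)) (by rw [hdim₁, hdim₂]; omega)
  rw [hdim₁, hdim₂, Nat.add_sub_cancel_left] at hMDS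
  exact ⟨_, hMDS⟩

/-- The distance `q - k + 2` is written `q + 2 - k`, since `k = q + 1` is allowed. -/
theorem theorem3p4 (p e q : ℕ) [Fact p.Prime] (hq : q = p ^ e) (hodd : Odd q) (hq3 : 3 < q)
    (F : Type*) [Field F] [Fintype F] [DecidableEq F] [Algebra (ZMod p) F]
    (hF : Fintype.card F = q) :
    (∀ k : ℕ, ⌈((q : ℚ) + 2) / 2⌉₊ ≤ k → k ≤ q + 1 →
      ∃ Q : Submodule ℂ (QuantumCode.StateSpace F (q + 1)),
        QuantumCode.IsMDS p Q (2 * k - q - 1) (q + 2 - k)) ∧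
    ∃ Q : Submodule ℂ (QuantumCode.StateSpace F (q + 1)),
      QuantumCode.IsMDS p Q 0 ((q + 1) / 2 + 1) := by
  obtain ⟨s, hs⟩ := hodd
  refine ⟨fun k hk hkq => ?_, theorem3p4_general p (by omega) (by omega) (by omega) (by omega)
    (by omega)⟩
  have hqk : q + 2 ≤ k * 2 := by
    rw [Nat.ceil_le, div_le_iff₀ two_pos] at hk
    exact_mod_cast hk
  exact theorem3p4_general p (by omega) (by omega) (by omega) (by omega) (by omega)
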